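/- For an integer $n\ge 0$ and a real number $A$ let $d(n,A)$ denote the number of positive divisors of $n$ not exceeding $A$ (in particular $d(0,A)=\lfloor A\rfloor$ for $A\ge 0$, since every positive integer divides $0$). Let $N\ge 1$ be an integer and let $A>1$ be a real number. Then $$\sum_{n=2}^{N} d(n^2-1,A)\;\le\; 4N\left(3\pi^{-2}\log^2 A+1.3949\log A+0.4107+3.253\,A^{-1/3}\right).$$ If moreover $A\le N$, then the term $n=1$, which equals $d(0,A)=\lfloor A\rfloor$, may be included: $$\sum_{n=1}^{N} d(n^2-1,A)\;\le\; 4N\left(3\pi^{-2}\log^2 A+1.3949\log A+0.4107+3.253\,A^{-1/3}\right).$$ -/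

import Mathlib

/-- `d(n, A)`: the number of (positive) divisors of `n` not exceeding the real number `A`.
Every positive integer divides `0`, so the value at `n = 0` is `⌊A⌋` for `A ≥ 0`. -/
noncomputable def divisorCountUpTo (n : ℕ) (A : ℝ) : ℕ :=
  Set.ncard {m : ℕ | 0 < m ∧ m ∣ n ∧ (m : ℝ) ≤ A}

/-!
Write `L = log A`. The right-hand side is at least
`N (1.21 L² + 5.5796 L + 1.6428 + 13.012 exp (-L / 3))`, because `12 / π² > 1.21`. As
`A` and `N` grow, the leading term of the sum is at most about half of `1.21 N L²`, which leaves room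
for elementary counting. Two
ranges are treated separately.

If `A ≤ N`, a divisor `d` of `(n - 1) (n + 1)` is encoded by the pair `a = gcd d (n - 1)`,
`b = d / a`, for which `a ∣ n - 1`, `b ∣ n + 1` and `a b = d ≤ A`. For a fixed pair these conditions
force `gcd a b ∣ 2`, so `n` lies in one residue class modulo `lcm a b ≥ a b / 2`, and there are at
most `2 N / (a b) + 1` such `n ≤ N`. Summing over `a b ≤ A` gives at most `N (L² + 5 L + 3)`
(`sum_divisorCountUpTo_le`).

If `A ≥ N`, all divisors of `n ^ 2 - 1` are counted. For `n = 2 j` the factors `2 j - 1` and `2 j + 1`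
are odd and coprime; for `n = 2 j + 1` one has `n ^ 2 - 1 = 4 j (j + 1)`, and multiplying an even
number by `4` at most doubles its number of divisors. In both cases there remains a sum of products
of two divisor functions at coprime arguments. Keeping in each factor only the divisors up to the
square root (at the cost of a factor `2`) makes it a count over pairs `(a, b)` in a box of side
`O(√N)`, where each pair fixes one residue class modulo `a b`: the main term is the square of a
harmonic sum and the error terms sum to `O(N)`. The result is
`N (1.125 log² N + 3.76 log N + 10.1)` for `N ≥ 16` (`sum_card_divisors_le_of_large`). For `N ≤ 15`
the inequality `d(n ^ 2 - 1) ≤ 2 (n - 1)` suffices, since the right-hand side is at least `14 N`.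
-/

namespace DivisorSumBound

/-! ### Counting integers in residue classes -/

lemma modEq_of_dvd_of_dvd {a x y : ℕ} (hx : a ∣ x) (hy : a ∣ y) : x ≡ y [MOD a] :=
  ((Nat.modEq_zero_iff_dvd).2 hx).trans ((Nat.modEq_zero_iff_dvd).2 hy).symm

/-- A set of integers in `[1, N]` that are all congruent modulo `m` has at most `N / m + 1`
elements. -/
lemma card_le_of_modEq {N m : ℕ} (s : Finset ℕ) (hs : s ⊆ Finset.Icc 1 N)
    (h : ∀ x ∈ s, ∀ y ∈ s, x ≡ y [MOD m]) : (s.card : ℝ) ≤ N / m + 1 := by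
  have h1 : s.card ≤ (Finset.range (N / m + 1)).card := by
    refine Finset.card_le_card_of_injOn (fun x => x / m) ?_ ?_
    · intro x hx
      have := (Finset.mem_Icc.1 (hs hx)).2
      simpa [Nat.lt_succ_iff] using Nat.div_le_div_right (c := m) this
    · intro x hx y hy hxy
      have h2 : x % m = y % m := h x hx y hy
      have h3 : x / m = y / m := hxy
      rw [← Nat.div_add_mod x m, ← Nat.div_add_mod y m, h2, h3]
  rw [Finset.card_range] at h1
  calc (s.card : ℝ) ≤ ((N / m + 1 : ℕ) : ℝ) := by exact_mod_cast h1
    _ ≤ N / m + 1 := by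
      push_cast
      gcongr
      exact Nat.cast_div_le

/-- The conditions `a ∣ n - 1` and `b ∣ n + 1` force `gcd a b ∣ 2`, so they fix `n` modulo
`lcm a b ≥ a b / 2`. -/
lemma card_dvd_pred_dvd_succ_le {a b : ℕ} (ha : 0 < a) (hb : 0 < b) (N : ℕ) :
    (((Finset.Icc 1 N).filter (fun n => a ∣ n - 1 ∧ b ∣ n + 1)).card : ℝ)
      ≤ 2 * N / (a * b) + 1 := by
  have haR : (0 : ℝ) < a := by exact_mod_cast ha
  have hbR : (0 : ℝ) < b := by exact_mod_cast hb
  set s := (Finset.Icc 1 N).filter (fun n => a ∣ n - 1 ∧ b ∣ n + 1) with hs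
  rcases s.eq_empty_or_nonempty with h0 | ⟨n, hn⟩
  · rw [h0, Finset.card_empty, Nat.cast_zero]
    positivity
  have hg : Nat.gcd a b ∣ 2 := by
    obtain ⟨hn1, hn2, hn3⟩ := Finset.mem_filter.1 hn
    have h1 := (Finset.mem_Icc.1 hn1).1
    have := Nat.dvd_sub ((Nat.gcd_dvd_right a b).trans hn3) ((Nat.gcd_dvd_left a b).trans hn2)
    rwa [show n + 1 - (n - 1) = 2 by omega] at this
  have hl : a * b ≤ 2 * Nat.lcm a b := by
    rw [← Nat.gcd_mul_lcm a b]
    exact Nat.mul_le_mul_right _ (Nat.le_of_dvd two_pos hg)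
  have hlpos : 0 < Nat.lcm a b := Nat.lcm_pos ha hb
  refine (card_le_of_modEq (m := Nat.lcm a b) s (Finset.filter_subset _ _) ?_).trans ?_
  · intro x hx y hy
    obtain ⟨hx1, hx2, hx3⟩ := Finset.mem_filter.1 hx
    obtain ⟨hy1, hy2, hy3⟩ := Finset.mem_filter.1 hy
    have hx1 := (Finset.mem_Icc.1 hx1).1
    have hy1 := (Finset.mem_Icc.1 hy1).1
    have e1 : x - 1 ≡ y - 1 [MOD a] :=
      modEq_of_dvd_of_dvd hx2 hy2
    have e2 : x + 1 ≡ y + 1 [MOD b] :=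
      modEq_of_dvd_of_dvd hx3 hy3
    have e1' : x ≡ y [MOD a] := by
      have := e1.add_right 1
      rwa [Nat.sub_add_cancel hx1, Nat.sub_add_cancel hy1] at this
    have e2' : x ≡ y [MOD b] := Nat.ModEq.add_right_cancel' 1 e2
    rw [Nat.modEq_iff_dvd] at e1' e2' ⊢
    exact_mod_cast Int.coe_lcm_dvd e1' e2'
  · have hlR : (a : ℝ) * b ≤ 2 * (Nat.lcm a b : ℕ) := by exact_mod_cast hl
    have hlR0 : (0 : ℝ) < (Nat.lcm a b : ℕ) := by exact_mod_cast hlpos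
    gcongr ?_ + 1
    rw [div_le_div_iff₀ hlR0 (by positivity)]
    nlinarith [Nat.cast_nonneg (α := ℝ) N]

/-! ### Harmonic sums -/

/-- Proved by comparing `1 / (2 i + 1)` with half the increment of `log` over
`[2 i - 1, 2 i + 1]`. -/
lemma sum_one_div_odd_le (k : ℕ) :
    ∑ i ∈ Finset.range (k + 1), (1 : ℝ) / (2 * i + 1) ≤ 1 + Real.log (2 * k + 1) / 2 := by
  induction k with
  | zero => simp
  | succ k ih =>
    rw [Finset.sum_range_succ]
    have h1 : (0 : ℝ) < 2 * k + 1 := by positivity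
    have h2 : (0 : ℝ) < 2 * k + 3 := by positivity
    have h3 := Real.one_sub_inv_le_log_of_pos (div_pos h2 h1)
    rw [Real.log_div h2.ne' h1.ne', inv_div] at h3
    have h4 : (1 : ℝ) - (2 * k + 1) / (2 * k + 3) = 2 * (1 / (2 * k + 3)) := by
      field_simp; ring
    push_cast
    rw [show (2 : ℝ) * (k + 1) + 1 = 2 * k + 3 by ring]
    linarith

lemma sum_one_div_Icc_floor_le {y : ℝ} (hy : 1 ≤ y) :
    ∑ b ∈ Finset.Icc 1 ⌊y⌋₊, (1 : ℝ) / b ≤ 1 + Real.log y := by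
  have := harmonic_floor_le_one_add_log y hy
  rw [harmonic_eq_sum_Icc] at this
  push_cast at this
  simpa [one_div] using this

/-- Comparison of the decreasing function `log (A / x) / x` with its integral over `[1, M + 1]`; the
term `a = 1` contributes `log A`. -/
lemma sum_log_div_le {A : ℝ} (M : ℕ) (hM : ((M + 1 : ℕ) : ℝ) ≤ A) :
    ∑ a ∈ Finset.Icc 1 (M + 1), Real.log (A / a) / a
      ≤ Real.log A + Real.log A ^ 2 / 2 - Real.log (A / (M + 1 : ℕ)) ^ 2 / 2 := by
  induction M with
  | zero => simp
  | succ M ih =>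
    have hM' : ((M + 1 : ℕ) : ℝ) ≤ A := by push_cast at hM ⊢; linarith
    rw [Finset.sum_Icc_succ_top (by omega)]
    refine (add_le_add_left (ih hM') _).trans ?_
    have p1 : (0 : ℝ) < (M + 1 : ℕ) := by positivity
    have p2 : (0 : ℝ) < (M + 1 + 1 : ℕ) := by positivity
    have hA : 0 < A := p1.trans_le hM'
    have h3 := Real.one_sub_inv_le_log_of_pos (div_pos p2 p1)
    rw [Real.log_div p2.ne' p1.ne', inv_div] at h3
    have h4 : (1 : ℝ) - ((M + 1 : ℕ) : ℝ) / (M + 1 + 1 : ℕ) = 1 / (M + 1 + 1 : ℕ) := by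
      rw [eq_div_iff p2.ne', sub_mul, div_mul_cancel₀ _ p2.ne']
      push_cast; ring
    have h5 : 0 ≤ Real.log (A / (M + 1 + 1 : ℕ)) :=
      Real.log_nonneg ((one_le_div p2).2 hM)
    rw [Real.log_div hA.ne' p1.ne']
    rw [Real.log_div hA.ne' p2.ne'] at h5 ⊢
    rw [h4] at h3
    set u := Real.log (M + 1 + 1 : ℕ)
    set v := Real.log (M + 1 : ℕ)
    rw [div_eq_mul_one_div (Real.log A - u)]
    nlinarith [mul_le_mul_of_nonneg_left h3 h5, sq_nonneg (u - v)]

/-! ### Divisors up to a bound below `N` -/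

/-- The pairs `(a, b)` of positive integers with `a * b ≤ M`, as a sigma type so that sums over them
are iterated sums with `b ≤ M / a`. -/
def hyperbolaPairs (M : ℕ) : Finset (Σ _ : ℕ, ℕ) :=
  (Finset.Icc 1 M).sigma (fun a => Finset.Icc 1 (M / a))

lemma sum_hyperbolaPairs_le {A : ℝ} (hA : 1 < A) :
    ∑ p ∈ hyperbolaPairs ⌊A⌋₊, (1 : ℝ) / (p.1 * p.2)
      ≤ Real.log A ^ 2 / 2 + 2 * Real.log A + 1 := by
  have hM : 1 ≤ ⌊A⌋₊ := (Nat.one_le_floor_iff A).2 hA.le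
  have hMA : ((⌊A⌋₊ : ℕ) : ℝ) ≤ A := Nat.floor_le (by linarith)
  have hlog : ∑ a ∈ Finset.Icc 1 ⌊A⌋₊, Real.log (A / a) / a
      ≤ Real.log A + Real.log A ^ 2 / 2 := by
    obtain ⟨M, hM'⟩ : ∃ M, ⌊A⌋₊ = M + 1 := ⟨⌊A⌋₊ - 1, by omega⟩
    rw [hM'] at hMA ⊢
    exact (sum_log_div_le M hMA).trans (by nlinarith [sq_nonneg (Real.log (A / (M + 1 : ℕ)))])
  calc ∑ p ∈ hyperbolaPairs ⌊A⌋₊, (1 : ℝ) / (p.1 * p.2)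
      = ∑ a ∈ Finset.Icc 1 ⌊A⌋₊, ∑ b ∈ Finset.Icc 1 ⌊A / a⌋₊, (1 : ℝ) / (a * b) := by
        rw [hyperbolaPairs, Finset.sum_sigma]
        simp only [Nat.floor_div_natCast]
    _ ≤ ∑ a ∈ Finset.Icc 1 ⌊A⌋₊, (1 / (a : ℝ) + Real.log (A / a) / a) := by
        refine Finset.sum_le_sum fun a ha => ?_
        obtain ⟨ha1, ha2⟩ := Finset.mem_Icc.1 ha
        have haR : (0 : ℝ) < a := by exact_mod_cast ha1
        have haA : (a : ℝ) ≤ A := (Nat.cast_le.2 ha2).trans hMA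
        have := sum_one_div_Icc_floor_le ((one_le_div haR).2 haA)
        calc ∑ b ∈ Finset.Icc 1 ⌊A / a⌋₊, (1 : ℝ) / (a * b)
            = 1 / a * ∑ b ∈ Finset.Icc 1 ⌊A / a⌋₊, (1 : ℝ) / b := by
              rw [Finset.mul_sum]
              exact Finset.sum_congr rfl fun b _ => by rw [one_div_mul_one_div]
          _ ≤ 1 / a * (1 + Real.log (A / a)) := by gcongr
          _ = 1 / (a : ℝ) + Real.log (A / a) / a := by ring
    _ ≤ _ := by
        rw [Finset.sum_add_distrib]
        linarith [sum_one_div_Icc_floor_le hA.le]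

lemma card_hyperbolaPairs_le {A : ℝ} (hA : 1 < A) :
    ((hyperbolaPairs ⌊A⌋₊).card : ℝ) ≤ A * (1 + Real.log A) := by
  calc ((hyperbolaPairs ⌊A⌋₊).card : ℝ)
      = ∑ a ∈ Finset.Icc 1 ⌊A⌋₊, ((⌊A⌋₊ / a : ℕ) : ℝ) := by
        simp [hyperbolaPairs, Finset.card_sigma]
    _ ≤ ∑ a ∈ Finset.Icc 1 ⌊A⌋₊, A * (1 / (a : ℝ)) := by
        refine Finset.sum_le_sum fun a _ => Nat.cast_div_le.trans ?_
        rw [mul_one_div]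
        gcongr
        exact Nat.floor_le (by linarith)
    _ ≤ _ := by
        rw [← Finset.mul_sum]
        exact mul_le_mul_of_nonneg_left (sum_one_div_Icc_floor_le hA.le) (by linarith)

lemma divisorCountUpTo_eq_card {A : ℝ} (hA : 1 < A) (m : ℕ) :
    divisorCountUpTo m A = ((Finset.Icc 1 ⌊A⌋₊).filter (fun d => d ∣ m)).card := by
  rw [divisorCountUpTo, ← Set.ncard_coe_finset]
  congr 1
  ext d
  simp only [Set.mem_ofPred_eq, Finset.coe_filter, Finset.mem_Icc,
    Nat.le_floor_iff (show 0 ≤ A by linarith), Nat.succ_le_iff]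
  tauto

/-- A divisor `d` of `(n - 1) (n + 1)` is recovered from the pair `a = gcd d (n - 1)`, `b = d / a`,
and `b ∣ n + 1`. -/
lemma divisorCountUpTo_le_card_pairs {A : ℝ} (hA : 1 < A) (n : ℕ) :
    divisorCountUpTo (n ^ 2 - 1) A
      ≤ ((hyperbolaPairs ⌊A⌋₊).filter (fun p => p.1 ∣ n - 1 ∧ p.2 ∣ n + 1)).card := by
  rw [divisorCountUpTo_eq_card hA]
  refine Finset.card_le_card_of_injOn
    (fun d => (⟨Nat.gcd d (n - 1), d / Nat.gcd d (n - 1)⟩ : Σ _ : ℕ, ℕ)) ?_ ?_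
  · intro d hd
    obtain ⟨hd1, hd2⟩ := Finset.mem_filter.1 hd
    obtain ⟨hd0, hdM⟩ := Finset.mem_Icc.1 hd1
    have hg : 0 < Nat.gcd d (n - 1) := Nat.gcd_pos_of_pos_left _ hd0
    have hgd : Nat.gcd d (n - 1) ≤ d := Nat.le_of_dvd hd0 (Nat.gcd_dvd_left _ _)
    have hfac : n ^ 2 - 1 = (n - 1) * (n + 1) := by
      rw [mul_comm]; simpa using Nat.sq_sub_sq n 1
    simp only [hyperbolaPairs, Finset.coe_filter, Finset.mem_sigma, Finset.mem_Icc,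
      Set.mem_ofPred_eq]
    refine ⟨⟨⟨hg, hgd.trans hdM⟩, Nat.div_pos hgd hg, Nat.div_le_div_right hdM⟩,
      Nat.gcd_dvd_right _ _, ?_⟩
    rw [hfac] at hd2
    have h1 : d / Nat.gcd d (n - 1) ∣ (n - 1) / Nat.gcd d (n - 1) * (n + 1) := by
      rw [Nat.div_mul_right_comm (Nat.gcd_dvd_right _ _)]
      exact Nat.div_dvd_div (Nat.gcd_dvd_left _ _) hd2
    exact (Nat.coprime_div_gcd_div_gcd hg).dvd_of_dvd_mul_left h1
  · intro d _ e _ hde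
    simp only [Sigma.mk.injEq, heq_eq_eq] at hde
    rw [← Nat.mul_div_cancel' (Nat.gcd_dvd_left d (n - 1)),
      ← Nat.mul_div_cancel' (Nat.gcd_dvd_left e (n - 1)), hde.2, hde.1]

lemma sum_divisorCountUpTo_le {A : ℝ} (hA : 1 < A) {N : ℕ} (hAN : A ≤ N) :
    ∑ n ∈ Finset.Icc 1 N, (divisorCountUpTo (n ^ 2 - 1) A : ℝ)
      ≤ N * (Real.log A ^ 2 + 5 * Real.log A + 3) := by
  have hL : 0 ≤ Real.log A := Real.log_nonneg hA.le
  calc ∑ n ∈ Finset.Icc 1 N, (divisorCountUpTo (n ^ 2 - 1) A : ℝ)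
      ≤ ∑ n ∈ Finset.Icc 1 N,
          (((hyperbolaPairs ⌊A⌋₊).filter (fun p => p.1 ∣ n - 1 ∧ p.2 ∣ n + 1)).card : ℝ) :=
        Finset.sum_le_sum fun n _ => by
          exact_mod_cast divisorCountUpTo_le_card_pairs hA n
    _ = ∑ p ∈ hyperbolaPairs ⌊A⌋₊,
          (((Finset.Icc 1 N).filter (fun n => p.1 ∣ n - 1 ∧ p.2 ∣ n + 1)).card : ℝ) := by
        exact_mod_cast Finset.sum_card_bipartiteAbove_eq_sum_card_bipartiteBelow _
    _ ≤ ∑ p ∈ hyperbolaPairs ⌊A⌋₊, (2 * N * (1 / ((p.1 : ℝ) * p.2)) + 1) := by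
        refine Finset.sum_le_sum fun p hp => ?_
        simp only [hyperbolaPairs, Finset.mem_sigma, Finset.mem_Icc] at hp
        rw [mul_one_div]
        exact card_dvd_pred_dvd_succ_le hp.1.1 hp.2.1 N
    _ = 2 * N * (∑ p ∈ hyperbolaPairs ⌊A⌋₊, (1 : ℝ) / (p.1 * p.2))
          + (hyperbolaPairs ⌊A⌋₊).card := by
        rw [Finset.sum_add_distrib, Finset.mul_sum]
        simp
    _ ≤ 2 * N * (Real.log A ^ 2 / 2 + 2 * Real.log A + 1) + N * (1 + Real.log A) := by
        gcongr
        · exact sum_hyperbolaPairs_le hA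
        · exact (card_hyperbolaPairs_le hA).trans (by gcongr)
    _ = _ := by ring

/-! ### All divisors -/

/-- The map `d ↦ m / d` exchanges the divisors above and below `√m`, so it is enough that `S`
contains the latter. -/
lemma card_divisors_le_two_mul {m : ℕ} (hm : m ≠ 0) (S : Finset ℕ)
    (hS : ∀ a, a ∣ m → a * a ≤ m → a ∈ S) :
    m.divisors.card ≤ 2 * (S.filter (fun a => a ∣ m)).card := by
  have h1 : (m.divisors.filter (fun a => a * a ≤ m)).card ≤ (S.filter (fun a => a ∣ m)).card := by
    refine Finset.card_le_card fun a ha => ?_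
    obtain ⟨ha1, ha2⟩ := Finset.mem_filter.1 ha
    have := Nat.dvd_of_mem_divisors ha1
    exact Finset.mem_filter.2 ⟨hS a this ha2, this⟩
  have h2 : (m.divisors.filter (fun a => ¬ a * a ≤ m)).card
      ≤ (S.filter (fun a => a ∣ m)).card := by
    refine Finset.card_le_card_of_injOn (fun a => m / a) ?_ ?_
    · intro a ha
      obtain ⟨ha1, ha2⟩ := Finset.mem_filter.1 ha
      have hd := Nat.dvd_of_mem_divisors ha1
      have he := Nat.div_mul_cancel hd
      have hlt : m / a ≤ a := by
        by_contra! hcon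
        nlinarith
      refine Finset.mem_coe.2 (Finset.mem_filter.2 ⟨hS _ (Nat.div_dvd_of_dvd hd) ?_,
        Nat.div_dvd_of_dvd hd⟩)
      calc m / a * (m / a) ≤ m / a * a := Nat.mul_le_mul_left _ hlt
        _ = m := he
    · intro a ha b hb hab
      have ha' := Nat.dvd_of_mem_divisors (Finset.mem_filter.1 ha).1
      have hb' := Nat.dvd_of_mem_divisors (Finset.mem_filter.1 hb).1
      have hab' : m / a = m / b := hab
      rw [← Nat.div_div_self ha' hm, hab', Nat.div_div_self hb' hm]
  have h3 := Finset.card_filter_add_card_filter_not (s := m.divisors) (fun a => a * a ≤ m)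
  omega

/-- With `m = 2 ^ v u`, `u` odd and `v ≥ 1`, the factor `v + 1` becomes `v + 3 ≤ 2 (v + 1)`. -/
lemma card_divisors_four_mul_le {m : ℕ} (hm : m ≠ 0) (h2 : 2 ∣ m) :
    (4 * m).divisors.card ≤ 2 * m.divisors.card := by
  obtain ⟨v, u, hu, rfl⟩ := Nat.exists_eq_two_pow_mul_odd hm
  have hv : 1 ≤ v := by
    rcases Nat.eq_zero_or_pos v with rfl | h
    · rw [pow_zero, one_mul] at h2
      exact absurd h2 hu.not_two_dvd_nat
    · exact h
  have hc : ∀ w, Nat.Coprime (2 ^ w) u := fun w =>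
    (Nat.coprime_two_left.2 hu).pow_left w
  rw [show 4 * (2 ^ v * u) = 2 ^ (v + 2) * u by ring, (hc _).card_divisors_mul,
    (hc _).card_divisors_mul, Nat.divisors_prime_pow Nat.prime_two,
    Nat.divisors_prime_pow Nat.prime_two, Finset.card_map, Finset.card_map, Finset.card_range,
    Finset.card_range, ← mul_assoc]
  exact Nat.mul_le_mul_right _ (by omega)

/-- If each pair `(a, b)` in the box `S × S` divides `(u j, v j)` for at most `K / (a b) + 1` values
of `j ≤ K`, then exchanging the order of summation factors the main term as a square. -/
lemma sum_card_mul_card_le (K : ℕ) (S : Finset ℕ) (u v : ℕ → ℕ)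
    (h : ∀ a ∈ S, ∀ b ∈ S,
      (((Finset.Icc 1 K).filter (fun j => a ∣ u j ∧ b ∣ v j)).card : ℝ)
        ≤ K / ((a * b : ℕ) : ℝ) + 1) :
    ∑ j ∈ Finset.Icc 1 K,
      ((S.filter (fun a => a ∣ u j)).card : ℝ) * ((S.filter (fun b => b ∣ v j)).card : ℝ)
      ≤ K * (∑ a ∈ S, (1 : ℝ) / a) ^ 2 + (S.card : ℝ) ^ 2 := by
  calc ∑ j ∈ Finset.Icc 1 K,
      ((S.filter (fun a => a ∣ u j)).card : ℝ) * ((S.filter (fun b => b ∣ v j)).card : ℝ)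
      = ∑ j ∈ Finset.Icc 1 K,
          (((S ×ˢ S).filter (fun p => p.1 ∣ u j ∧ p.2 ∣ v j)).card : ℝ) := by
        refine Finset.sum_congr rfl fun j _ => ?_
        rw [Finset.filter_product (fun a => a ∣ u j) (fun b => b ∣ v j), Finset.card_product,
          Nat.cast_mul]
    _ = ∑ p ∈ S ×ˢ S, (((Finset.Icc 1 K).filter (fun j => p.1 ∣ u j ∧ p.2 ∣ v j)).card : ℝ) := by
        exact_mod_cast Finset.sum_card_bipartiteAbove_eq_sum_card_bipartiteBelow
          (s := Finset.Icc 1 K) (t := S ×ˢ S) (fun j p => p.1 ∣ u j ∧ p.2 ∣ v j)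
    _ ≤ ∑ p ∈ S ×ˢ S, (K * ((1 / (p.1 : ℝ)) * (1 / (p.2 : ℝ))) + 1) := by
        refine Finset.sum_le_sum fun p hp => ?_
        rw [Finset.mem_product] at hp
        refine (h p.1 hp.1 p.2 hp.2).trans_eq ?_
        rw [one_div_mul_one_div, mul_one_div, Nat.cast_mul]
    _ = _ := by
        rw [Finset.sum_add_distrib, ← Finset.mul_sum, Finset.sum_product, sq, sq,
          Finset.sum_mul_sum]
        simp

/-- The odd integers in `[1, 2 k + 1]`. -/
def oddsUpTo (k : ℕ) : Finset ℕ := (Finset.range (k + 1)).image (fun i => 2 * i + 1)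

lemma mem_oddsUpTo {k a : ℕ} : a ∈ oddsUpTo k ↔ Odd a ∧ a ≤ 2 * k + 1 := by
  simp only [oddsUpTo, Finset.mem_image, Finset.mem_range]
  constructor
  · rintro ⟨i, hi, rfl⟩
    exact ⟨⟨i, rfl⟩, by omega⟩
  · rintro ⟨⟨i, rfl⟩, h⟩
    exact ⟨i, by omega, rfl⟩

lemma card_oddsUpTo_le (k : ℕ) : (oddsUpTo k).card ≤ k + 1 :=
  Finset.card_image_le.trans (Finset.card_range _).le

lemma sum_oddsUpTo_le (k : ℕ) :
    ∑ a ∈ oddsUpTo k, (1 : ℝ) / a ≤ 1 + Real.log (2 * k + 1) / 2 := by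
  rw [oddsUpTo, Finset.sum_image (fun x _ y _ h => by simpa using h)]
  push_cast
  exact sum_one_div_odd_le k

/-- Contribution of the even integers `n = 2 j`. The hypothesis says that the odd integers up to
`2 k + 1` include all the odd ones up to `√(2 K + 1)`. -/
lemma sum_card_divisors_even_le (K k : ℕ) (hk : 2 * K + 1 < (2 * k + 3) ^ 2) :
    ∑ j ∈ Finset.Icc 1 K, (((2 * j) ^ 2 - 1).divisors.card : ℝ)
      ≤ 4 * (K * (1 + Real.log (2 * k + 1) / 2) ^ 2 + ((k : ℝ) + 1) ^ 2) := by
  have hodd : ∀ m, Odd m → m ≤ 2 * K + 1 →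
      m.divisors.card ≤ 2 * ((oddsUpTo k).filter (fun a => a ∣ m)).card := by
    intro m hm hmK
    refine card_divisors_le_two_mul hm.pos.ne' _ fun a ha haa => ?_
    have hao : Odd a := hm.of_dvd_nat ha
    refine mem_oddsUpTo.2 ⟨hao, ?_⟩
    have : a < 2 * k + 3 := by
      by_contra! hcon
      nlinarith
    obtain ⟨i, rfl⟩ := hao
    omega
  have hpt : ∀ j ∈ Finset.Icc 1 K, (((2 * j) ^ 2 - 1).divisors.card : ℝ)
      ≤ 4 * (((oddsUpTo k).filter (fun a => a ∣ 2 * j - 1)).card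
        * ((oddsUpTo k).filter (fun a => a ∣ 2 * j + 1)).card) := by
    intro j hj
    obtain ⟨hj1, hj2⟩ := Finset.mem_Icc.1 hj
    have e : (2 * j) ^ 2 - 1 = (2 * j - 1) * (2 * j + 1) := by
      rw [mul_comm (2 * j - 1)]; simpa using Nat.sq_sub_sq (2 * j) 1
    have o1 : Odd (2 * j - 1) := ⟨j - 1, by omega⟩
    have hc : Nat.Coprime (2 * j - 1) (2 * j + 1) := by
      rw [show 2 * j + 1 = 2 + (2 * j - 1) by omega, Nat.coprime_add_self_right]
      exact Nat.coprime_two_right.2 o1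
    rw [e, hc.card_divisors_mul]
    have := Nat.mul_le_mul (hodd (2 * j - 1) o1 (by omega)) (hodd (2 * j + 1) ⟨j, rfl⟩ (by omega))
    calc _ ≤ _ := Nat.cast_le (α := ℝ).2 this
      _ = _ := by push_cast; ring
  refine (Finset.sum_le_sum hpt).trans ?_
  rw [← Finset.mul_sum]
  gcongr 4 * ?_
  refine (sum_card_mul_card_le K (oddsUpTo k) (fun j => 2 * j - 1) (fun j => 2 * j + 1) ?_).trans ?_
  · intro a ha b hb
    have hao := (mem_oddsUpTo.1 ha).1
    have hbo := (mem_oddsUpTo.1 hb).1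
    refine card_le_of_modEq _ (Finset.filter_subset _ _) ?_
    intro x hx y hy
    obtain ⟨hx1, hx2, hx3⟩ := Finset.mem_filter.1 hx
    obtain ⟨hy1, hy2, hy3⟩ := Finset.mem_filter.1 hy
    have hx1 := (Finset.mem_Icc.1 hx1).1
    have hy1 := (Finset.mem_Icc.1 hy1).1
    have hab : Nat.Coprime a b := by
      have hg := Nat.dvd_sub ((Nat.gcd_dvd_right a b).trans hx3) ((Nat.gcd_dvd_left a b).trans hx2)
      rw [show 2 * x + 1 - (2 * x - 1) = 2 by omega] at hg
      exact Nat.Coprime.eq_one_of_dvd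
        (Nat.coprime_two_right.2 (hao.of_dvd_nat (Nat.gcd_dvd_left a b))) hg
    have e1 : x ≡ y [MOD a] := by
      have := (modEq_of_dvd_of_dvd hx2 hy2).add_right 1
      rw [Nat.sub_add_cancel (by omega), Nat.sub_add_cancel (by omega)] at this
      exact Nat.ModEq.cancel_left_of_coprime (Nat.coprime_two_right.2 hao) this
    have e2 : x ≡ y [MOD b] :=
      Nat.ModEq.cancel_left_of_coprime (Nat.coprime_two_right.2 hbo)
        (Nat.ModEq.add_right_cancel' 1 (modEq_of_dvd_of_dvd hx3 hy3))
    exact (Nat.modEq_and_modEq_iff_modEq_mul hab).1 ⟨e1, e2⟩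
  · have hc : ((oddsUpTo k).card : ℝ) ≤ (k : ℝ) + 1 := by exact_mod_cast card_oddsUpTo_le k
    gcongr
    exact sum_oddsUpTo_le k

/-- Contribution of the odd integers `n = 2 j + 1`. The hypothesis `hK` says that `R` is at least the
integer part of `√(K + 1)`. -/
lemma sum_card_divisors_odd_le (K R : ℕ) (hR : 1 ≤ R) (hK : K + 1 < (R + 1) ^ 2) :
    ∑ j ∈ Finset.Icc 1 K, (((2 * j + 1) ^ 2 - 1).divisors.card : ℝ)
      ≤ 8 * (K * (1 + Real.log R) ^ 2 + (R : ℝ) ^ 2) := by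
  have hdiv : ∀ m, 1 ≤ m → m ≤ K + 1 →
      m.divisors.card ≤ 2 * ((Finset.Icc 1 R).filter (fun a => a ∣ m)).card := by
    intro m hm hmK
    refine card_divisors_le_two_mul (by omega) _ fun a ha haa => ?_
    refine Finset.mem_Icc.2 ⟨Nat.pos_of_dvd_of_pos ha hm, ?_⟩
    by_contra! hcon
    nlinarith
  have hpt : ∀ j ∈ Finset.Icc 1 K, (((2 * j + 1) ^ 2 - 1).divisors.card : ℝ)
      ≤ 8 * (((Finset.Icc 1 R).filter (fun a => a ∣ j)).card
        * ((Finset.Icc 1 R).filter (fun a => a ∣ j + 1)).card) := by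
    intro j hj
    obtain ⟨hj1, hj2⟩ := Finset.mem_Icc.1 hj
    have e : (2 * j + 1) ^ 2 - 1 = 4 * (j * (j + 1)) := by
      rw [show (2 * j + 1) ^ 2 = 4 * (j * (j + 1)) + 1 by ring, Nat.add_sub_cancel]
    have h1 := card_divisors_four_mul_le (m := j * (j + 1)) (by positivity)
      (Nat.even_mul_succ_self j).two_dvd
    have hc : Nat.Coprime j (j + 1) := by simp
    rw [hc.card_divisors_mul] at h1
    have h2 := Nat.mul_le_mul (hdiv j hj1 (by omega)) (hdiv (j + 1) (by omega) (by omega))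
    rw [e]
    calc _ ≤ _ := Nat.cast_le (α := ℝ).2 (h1.trans (Nat.mul_le_mul_left 2 h2))
      _ = _ := by push_cast; ring
  refine (Finset.sum_le_sum hpt).trans ?_
  rw [← Finset.mul_sum]
  gcongr 8 * ?_
  refine (sum_card_mul_card_le K (Finset.Icc 1 R) (fun j => j) (fun j => j + 1) ?_).trans ?_
  · intro a ha b hb
    refine card_le_of_modEq _ (Finset.filter_subset _ _) ?_
    intro x hx y hy
    obtain ⟨-, hx2, hx3⟩ := Finset.mem_filter.1 hx
    obtain ⟨-, hy2, hy3⟩ := Finset.mem_filter.1 hy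
    have hab : Nat.Coprime a b :=
      Nat.Coprime.of_dvd hx2 hx3 (by simp)
    exact (Nat.modEq_and_modEq_iff_modEq_mul hab).1
      ⟨modEq_of_dvd_of_dvd hx2 hy2, Nat.ModEq.add_right_cancel' 1 (modEq_of_dvd_of_dvd hx3 hy3)⟩
  · have h1 := sum_one_div_Icc_floor_le (y := R) (by exact_mod_cast hR)
    rw [Nat.floor_natCast] at h1
    rw [Nat.card_Icc, Nat.add_sub_cancel]
    gcongr

lemma sum_Icc_two_eq (N : ℕ) (f : ℕ → ℝ) :
    ∑ n ∈ Finset.Icc 2 N, f n = ∑ j ∈ Finset.Icc 1 (N / 2), f (2 * j)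
      + ∑ j ∈ Finset.Icc 1 ((N - 1) / 2), f (2 * j + 1) := by
  rw [← Finset.sum_filter_add_sum_filter_not (Finset.Icc 2 N) (fun n => n % 2 = 0)]
  congr 1
  · refine (Finset.sum_nbij' (fun j => 2 * j) (fun n => n / 2) ?_ ?_ ?_ ?_ ?_).symm <;>
      intro j hj <;> simp only [Finset.mem_Icc, Finset.mem_filter] at * <;> omega
  · refine (Finset.sum_nbij' (fun j => 2 * j + 1) (fun n => n / 2) ?_ ?_ ?_ ?_ ?_).symm <;>
      intro j hj <;> simp only [Finset.mem_Icc, Finset.mem_filter] at * <;> omega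

lemma sum_card_divisors_le_of_large {N : ℕ} (hN : 16 ≤ N) :
    ∑ n ∈ Finset.Icc 2 N, ((n ^ 2 - 1).divisors.card : ℝ)
      ≤ N * (1.125 * Real.log N ^ 2 + 3.76 * Real.log N + 10.1) := by
  have hNR : (16 : ℝ) ≤ N := by exact_mod_cast hN
  have hN0 : (0 : ℝ) < N := by linarith
  have hL : 0 ≤ Real.log N := Real.log_nonneg (by linarith)
  have hlog : Real.log (N + 1) ≤ Real.log N + 1 / 16 := by
    have h1 := Real.log_le_sub_one_of_pos (show (0 : ℝ) < (N + 1) / N by positivity)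
    rw [Real.log_div (by positivity) hN0.ne'] at h1
    have h2 : ((N : ℝ) + 1) / N - 1 ≤ 1 / 16 := by
      rw [sub_le_iff_le_add, div_le_iff₀ hN0]
      linarith
    linarith
  have heven : ∑ j ∈ Finset.Icc 1 (N / 2), (((2 * j) ^ 2 - 1).divisors.card : ℝ)
      ≤ 2 * N * (1 + (Real.log N + 1 / 16) / 4) ^ 2 + 1.65 * N := by
    -- `2 k + 1` is the largest odd integer with square at most `N + 1`.
    set s := Nat.sqrt (N + 1) with hs
    have hs1 : s * s ≤ N + 1 := Nat.sqrt_le (N + 1)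
    have hs2 : N + 1 < (s + 1) * (s + 1) := Nat.lt_succ_sqrt (N + 1)
    have hs0 : 1 ≤ s := Nat.sqrt_pos.2 (by omega)
    obtain ⟨k, hk1, hk2⟩ : ∃ k, 2 * k + 1 ≤ s ∧ s ≤ 2 * k + 2 := ⟨(s - 1) / 2, by omega, by omega⟩
    have hK : ((N / 2 : ℕ) : ℝ) ≤ N / 2 := Nat.cast_div_le
    have hk : 2 * (N / 2) + 1 < (2 * k + 3) ^ 2 := by
      have h1 : (s + 1) * (s + 1) ≤ (2 * k + 3) * (2 * k + 3) :=
        Nat.mul_le_mul (by omega) (by omega)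
      rw [sq]
      omega
    have hs1R : (s : ℝ) * s ≤ N + 1 := by exact_mod_cast hs1
    have hs0R : (1 : ℝ) ≤ s := by exact_mod_cast hs0
    have hk1R : 2 * (k : ℝ) + 1 ≤ s := by exact_mod_cast hk1
    have hlogk : Real.log (2 * k + 1) ≤ (Real.log N + 1 / 16) / 2 := by
      have h1 : Real.log (2 * k + 1) ≤ Real.log s := Real.log_le_log (by positivity) hk1R
      have h2 : Real.log (s * s) ≤ Real.log (N + 1) := Real.log_le_log (by positivity) hs1R
      rw [Real.log_mul (by positivity) (by positivity)] at h2
      linarith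
    have hlogk0 : 0 ≤ Real.log (2 * k + 1) :=
      Real.log_nonneg (by linarith [Nat.cast_nonneg (α := ℝ) k])
    have hcard : 4 * ((k : ℝ) + 1) ^ 2 ≤ 1.65 * N := by
      have h1 : 4 * ((k : ℝ) + 1) ^ 2 ≤ (s + 1) ^ 2 := by
        nlinarith [Nat.cast_nonneg (α := ℝ) k]
      nlinarith [sq_nonneg ((s : ℝ) - 4)]
    have hsq : (1 + Real.log (2 * k + 1) / 2) ^ 2 ≤ (1 + (Real.log N + 1 / 16) / 4) ^ 2 :=
      pow_le_pow_left₀ (by linarith) (by linarith) 2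
    have hmul := mul_le_mul hK hsq (sq_nonneg _) (by linarith)
    linarith [sum_card_divisors_even_le (N / 2) k hk]
  have hodd : ∑ j ∈ Finset.Icc 1 ((N - 1) / 2), (((2 * j + 1) ^ 2 - 1).divisors.card : ℝ)
      ≤ N * (2 + (Real.log N - 0.63)) ^ 2 + 4.25 * N := by
    set K := (N - 1) / 2 with hK
    set R := Nat.sqrt (K + 1) with hR
    have hR1 : R * R ≤ K + 1 := Nat.sqrt_le (K + 1)
    have hR2 : K + 1 < (R + 1) * (R + 1) := Nat.lt_succ_sqrt (K + 1)
    have hR0 : 1 ≤ R := Nat.sqrt_pos.2 (by omega)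
    have hKN : 2 * (K : ℝ) + 1 ≤ N := by
      have : 2 * K + 1 ≤ N := by omega
      exact_mod_cast this
    have hR1R : (R : ℝ) * R ≤ K + 1 := by exact_mod_cast hR1
    have hR0R : (1 : ℝ) ≤ R := by exact_mod_cast hR0
    have hlogR : Real.log R ≤ (Real.log N - 0.63) / 2 := by
      have h2 : Real.log (2 * (R * R)) ≤ Real.log (N + 1) :=
        Real.log_le_log (by positivity) (by linarith)
      rw [Real.log_mul (by positivity) (by positivity),
        Real.log_mul (by positivity) (by positivity)] at h2
      linarith [Real.log_two_gt_d9]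
    have hlogR0 : 0 ≤ Real.log R := Real.log_nonneg hR0R
    have hsq : (1 + Real.log R) ^ 2 ≤ (1 + (Real.log N - 0.63) / 2) ^ 2 :=
      pow_le_pow_left₀ (by linarith) (by linarith) 2
    have hmul := mul_le_mul (show (K : ℝ) ≤ N / 2 by linarith) hsq (sq_nonneg _) (by linarith)
    nlinarith [sum_card_divisors_odd_le K R hR0 (by rw [sq]; exact hR2)]
  refine (sum_Icc_two_eq N (fun n => ((n ^ 2 - 1).divisors.card : ℝ))).trans_le ?_
  refine (add_le_add heven hodd).trans ?_
  rw [← sub_nonneg]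
  have : (N : ℝ) * (1.125 * Real.log N ^ 2 + 3.76 * Real.log N + 10.1)
      - (2 * N * (1 + (Real.log N + 1 / 16) / 4) ^ 2 + 1.65 * N
        + (N * (2 + (Real.log N - 0.63)) ^ 2 + 4.25 * N))
      = N * ((3.76 - 2.74 - 1.015625) * Real.log N
        + (10.1 - 1.65 - 4.25 - 1.37 ^ 2 - 2 * 1.015625 ^ 2)) := by ring
  rw [this]
  refine mul_nonneg hN0.le ?_
  norm_num
  linarith

/-- The divisors of `n ^ 2 - 1` up to its square root are among `1, …, n - 1`. -/
lemma card_divisors_sq_sub_one_le {n : ℕ} (hn : 2 ≤ n) :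
    (n ^ 2 - 1).divisors.card ≤ 2 * (n - 1) := by
  have h4 : 2 ^ 2 ≤ n ^ 2 := Nat.pow_le_pow_left hn 2
  refine (card_divisors_le_two_mul (by omega) (Finset.Icc 1 (n - 1)) fun a ha haa => ?_).trans ?_
  · have h0 := Nat.pos_of_dvd_of_pos ha (by omega)
    have : a < n := by
      by_contra! hcon
      have := Nat.mul_le_mul hcon hcon
      rw [← sq] at this
      omega
    exact Finset.mem_Icc.2 ⟨h0, by omega⟩
  · refine Nat.mul_le_mul_left 2 ((Finset.card_filter_le _ _).trans ?_)
    simp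

lemma sum_card_divisors_le_of_small {N : ℕ} (hN1 : 1 ≤ N) (hN : N ≤ 15) :
    ∑ n ∈ Finset.Icc 2 N, ((n ^ 2 - 1).divisors.card : ℝ) ≤ 14 * N := by
  -- Each term is at most `2 (n - 1)`, and these sum to `N (N - 1)`.
  have key : ∀ M : ℕ, ∑ n ∈ Finset.Icc 2 (M + 1), (n ^ 2 - 1).divisors.card ≤ M * (M + 1) := by
    intro M
    induction M with
    | zero => simp
    | succ M ih =>
      rw [Finset.sum_Icc_succ_top (by omega)]
      have := card_divisors_sq_sub_one_le (n := M + 1 + 1) (by omega)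
      rw [Nat.add_sub_cancel] at this
      nlinarith
  obtain ⟨M, rfl⟩ : ∃ M, N = M + 1 := ⟨N - 1, by omega⟩
  have h := (key M).trans (Nat.mul_le_mul_right (M + 1) (show M ≤ 14 by omega))
  exact_mod_cast h

lemma divisorCountUpTo_le_card_divisors {m : ℕ} (hm : m ≠ 0) (A : ℝ) :
    divisorCountUpTo m A ≤ m.divisors.card := by
  rw [divisorCountUpTo, ← Set.ncard_coe_finset]
  refine Set.ncard_le_ncard ?_ (Finset.finite_toSet _)
  rintro d ⟨-, hd, -⟩
  exact Finset.mem_coe.2 (Nat.mem_divisors.2 ⟨hd, hm⟩)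

/-! ### Comparison with the explicit bound -/

lemma pi_zpow_neg_two_gt : (0.3025 : ℝ) < Real.pi ^ (-2 : ℤ) * 3 := by
  have hp := Real.pi_pos
  have hlt := Real.pi_lt_d4
  rw [zpow_neg, inv_mul_eq_div, lt_div_iff₀ (by positivity)]
  norm_cast
  nlinarith

/-- The right-hand side in terms of `log A`, with `12 / π ^ 2` replaced by a smaller rational. -/
lemma polynomial_add_exp_le {A : ℝ} (hA : 1 < A) :
    1.21 * Real.log A ^ 2 + 5.5796 * Real.log A + 1.6428 + 13.012 * Real.exp (-(Real.log A / 3))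
      ≤ 4 * (3 * Real.pi ^ (-2 : ℤ) * Real.log A ^ 2 + 1.3949 * Real.log A + 0.4107
        + 3.253 * A ^ (-(1 / 3) : ℝ)) := by
  rw [Real.rpow_def_of_pos (by linarith),
    show Real.log A * (-(1 / 3)) = -(Real.log A / 3) by ring]
  nlinarith [mul_le_mul_of_nonneg_right pi_zpow_neg_two_gt.le (sq_nonneg (Real.log A))]

lemma quadratic_le_polynomial_add_exp {L : ℝ} (hL : 0 ≤ L) :
    L ^ 2 + 5 * L + 3
      ≤ 1.21 * L ^ 2 + 5.5796 * L + 1.6428 + 13.012 * Real.exp (-(L / 3)) := by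
  rcases le_total L 1.6 with h | h
  · nlinarith [Real.add_one_le_exp (-(L / 3))]
  · nlinarith [Real.exp_pos (-(L / 3))]

lemma const_le_polynomial_add_exp {L : ℝ} (hL : 0 ≤ L) :
    14 ≤ 1.21 * L ^ 2 + 5.5796 * L + 1.6428 + 13.012 * Real.exp (-(L / 3)) := by
  nlinarith [Real.add_one_le_exp (-(L / 3))]

lemma quadratic_le_polynomial_add_exp_of_large {L : ℝ} (hL : 2.77 ≤ L) :
    1.125 * L ^ 2 + 3.76 * L + 10.1
      ≤ 1.21 * L ^ 2 + 5.5796 * L + 1.6428 + 13.012 * Real.exp (-(L / 3)) := by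
  rcases le_total L 4 with h | h
  · have h1 : Real.exp (-(4 / 3)) ≤ Real.exp (-(L / 3)) := Real.exp_le_exp.2 (by linarith)
    -- `exp (-4/3) = exp (-1/6) ^ 8 ≥ (1 - 1/6) ^ 8 > 0.23`
    have h2 : 0.23 ≤ Real.exp (-(4 / 3)) := by
      have h3 := Real.add_one_le_exp (-(1 / 6) : ℝ)
      have h4 := pow_le_pow_left₀ (by norm_num) h3 8
      rw [← Real.exp_nat_mul, show ((8 : ℕ) : ℝ) * -(1 / 6) = -(4 / 3) by norm_num] at h4
      exact le_trans (by norm_num) h4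
    nlinarith
  · nlinarith [Real.exp_pos (-(L / 3))]

lemma sum_card_divisors_le {N : ℕ} (hN : 1 ≤ N) {A : ℝ} (hA : 1 < A) (hNA : N ≤ A) :
    ∑ n ∈ Finset.Icc 2 N, ((n ^ 2 - 1).divisors.card : ℝ)
      ≤ N * (1.21 * Real.log A ^ 2 + 5.5796 * Real.log A + 1.6428
        + 13.012 * Real.exp (-(Real.log A / 3))) := by
  rcases Nat.lt_or_ge N 16 with h | h
  · refine (sum_card_divisors_le_of_small hN (by omega)).trans ?_
    rw [mul_comm (14 : ℝ)]
    gcongr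
    exact const_le_polynomial_add_exp (Real.log_nonneg hA.le)
  · refine (sum_card_divisors_le_of_large h).trans ?_
    have h16 : (16 : ℝ) ≤ N := by exact_mod_cast h
    have h1 : Real.log N ≤ Real.log A := Real.log_le_log (by linarith) hNA
    have h2 : 2.77 ≤ Real.log N := by
      have h3 := Real.log_le_log (by norm_num) h16
      rw [show (16 : ℝ) = 2 ^ 4 by norm_num, Real.log_pow] at h3
      push_cast at h3
      linarith [Real.log_two_gt_d9]
    have h0 : 0 ≤ Real.log N := by linarith
    refine mul_le_mul_of_nonneg_left
      (le_trans ?_ (quadratic_le_polynomial_add_exp_of_large (h2.trans h1))) (Nat.cast_nonneg N)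
    gcongr

end DivisorSumBound

open DivisorSumBound in
theorem mainTheorem9 (N : ℕ) (hN : 1 ≤ N) (A : ℝ) (hA : 1 < A) :
    ((∑ n ∈ Finset.Icc 2 N, (divisorCountUpTo (n ^ 2 - 1) A : ℝ)) ≤
      4 * (N : ℝ) * (3 * Real.pi ^ (-2 : ℤ) * Real.log A ^ 2 + 1.3949 * Real.log A + 0.4107
        + 3.253 * A ^ (-(1 / 3) : ℝ))) ∧
    (A ≤ (N : ℝ) →
      (∑ n ∈ Finset.Icc 1 N, (divisorCountUpTo (n ^ 2 - 1) A : ℝ)) ≤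
      4 * (N : ℝ) * (3 * Real.pi ^ (-2 : ℤ) * Real.log A ^ 2 + 1.3949 * Real.log A + 0.4107
        + 3.253 * A ^ (-(1 / 3) : ℝ))) := by
  rw [mul_comm 4 (N : ℝ), mul_assoc (N : ℝ)]
  have hN0 : (0 : ℝ) ≤ N := Nat.cast_nonneg N
  have hbound := mul_le_mul_of_nonneg_left (polynomial_add_exp_le hA) hN0
  have hsmall : A ≤ (N : ℝ) → (∑ n ∈ Finset.Icc 1 N, (divisorCountUpTo (n ^ 2 - 1) A : ℝ)) ≤
      N * (4 * (3 * Real.pi ^ (-2 : ℤ) * Real.log A ^ 2 + 1.3949 * Real.log A + 0.4107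
        + 3.253 * A ^ (-(1 / 3) : ℝ))) := fun hAN =>
    ((sum_divisorCountUpTo_le hA hAN).trans (mul_le_mul_of_nonneg_left
      (quadratic_le_polynomial_add_exp (Real.log_nonneg hA.le)) hN0)).trans hbound
  refine ⟨?_, hsmall⟩
  rcases le_total A N with h | h
  · refine le_trans ?_ (hsmall h)
    exact Finset.sum_le_sum_of_subset_of_nonneg (Finset.Icc_subset_Icc_left (by norm_num))
      fun _ _ _ => Nat.cast_nonneg _
  · refine le_trans ?_ ((sum_card_divisors_le hN hA h).trans hbound)
    refine Finset.sum_le_sum fun n hn => Nat.cast_le.2 (divisorCountUpTo_le_card_divisors ?_ A)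
    have h4 : 2 ^ 2 ≤ n ^ 2 := Nat.pow_le_pow_left (Finset.mem_Icc.1 hn).1 2
    omega
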